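/- Let $P$ be a poset, regarded as a category with a unique morphism $p \to q$ whenever $p \le q$, and let $\mathsf{PSh}(P)$ be the category of presheaves of sets on $P$. Let $X$ be the dcpo of filters on $P$ (nonempty, downward directed, upward closed subsets of $P$), ordered by inclusion and equipped with the Scott topology. Then $\mathsf{PSh}(P) \simeq \mathsf{Sh}(X)$, and the following are equivalent: 1. $\mathsf{PSh}(P) \simeq \mathsf{Sh}(X)$ is a coherent topos (that is, $\mathsf{PSh}(P)$ is coherent; equivalently, $\mathsf{Sh}(X)$ is coherent); 2. $X$ is a spectral space, i.e. it is sober and compact, and its compact open subsets are closed under binary intersections and form a basis of the topology; 3. there is a finite (possibly empty) list $t_1,\dots,t_k \in P$ such that for every $p \in P$ there is some $i$ with $p \le t_i$; and, for all $p,q \in P$, the same holds for the subposet $\downarrow p\, \cap \downarrow q$ of $P$ (with the list consisting of elements of $\downarrow p\, \cap \downarrow q$), where $\downarrow p = \{r \in P : r \le p\}$. Here an object $E$ of a topos is called compact if every (small) epimorphic family with codomain $E$ contains a finite epimorphic subfamily, and a topos (meaning a Grothendieck topos) is called coherent if it contains a full subcategory of compact generators that is closed under finite limits. -/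

import Mathlib

open CategoryTheory CategoryTheory.Limits

universe v u

/-- A Grothendieck topos: a category equivalent to the category of sheaves of sets on a
small site. -/
def IsGrothendieckTopos (C : Type u) [Category.{v} C] : Prop :=
  ∃ (D : Type v) (_ : SmallCategory.{v} D) (J : GrothendieckTopology D),
    Nonempty (C ≌ Sheaf J (Type v))

/-- A family of morphisms with common codomain `E` is epimorphic if two morphisms out of `E`
agree as soon as they agree after composition with every member of the family. -/
def IsEpimorphicFamily {C : Type u} [Category.{v} C] {ι : Type v} {E : C} {F : ι → C}
    (f : ∀ i, F i ⟶ E) : Prop :=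
  ∀ ⦃Z : C⦄ (g h : E ⟶ Z), (∀ i, f i ≫ g = f i ≫ h) → g = h

/-- An object `E` of a topos is compact if every (small) epimorphic family with codomain `E`
contains a finite epimorphic subfamily. -/
def IsCompactObject {C : Type u} [Category.{v} C] (E : C) : Prop :=
  ∀ ⦃ι : Type v⦄ (F : ι → C) (f : ∀ i, F i ⟶ E), IsEpimorphicFamily f →
    ∃ s : Finset ι, IsEpimorphicFamily (fun i : {i : ι // i ∈ s} => f i.1)

/-- A coherent topos: a topos containing a full subcategory `K` of compact generators which is
closed under finite limits. -/
def IsCoherentTopos (C : Type u) [Category.{v} C] : Prop :=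
  IsGrothendieckTopos C ∧
    ∃ K : ObjectProperty C,
      (∀ E : C, K E → IsCompactObject E) ∧
      K.IsSeparating ∧
      ∀ (J : Type) [SmallCategory J] [FinCategory J], K.IsClosedUnderLimitsOfShape J

/-- The dcpo of filters on `P` (nonempty, down-directed, upward closed subsets), ordered by
inclusion and equipped with the Scott topology. -/
abbrev FilterDcpo (P : Type u) [PartialOrder P] : Type u :=
  Topology.WithScott (Order.PFilter P)

/-- There is a finite (possibly empty) list of elements such that every element lies below
one of them. -/
def HasFiniteCofinalList (Q : Type u) [Preorder Q] : Prop :=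
  ∃ l : List Q, ∀ p : Q, ∃ t ∈ l, p ≤ t


/-!
Write `L` for the frame of lower sets of `P`. The principal filters make `P` a basis of join-prime
opens of the filter space, so the frame of opens is `L`, and the comparison lemma identifies sheaves
on the filter space with presheaves on `P`. The filter space is sober with a basis of compact opens,
hence it is spectral exactly when the compact elements of `L` are closed under finite meets; as
these compact elements are the finite unions of principal lower sets, this is the condition on
finite cofinal lists.

For the topos, send a presheaf to its support, an element of `L`. Compact presheaves are the
finitely generated ones, so their supports are compact, and support preserves finite products.
Every separating family contains an object with support `Iic p`; if its objects are compact and it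
has finite products, then `⊤` and all `Iic p ⊓ Iic q` are compact. Conversely, the compact
subterminal presheaves include the representables, hence generate, and since limits of subterminal
presheaves are meets of supports, they are closed under finite limits as soon as the compact
elements of `L` are closed under finite meets.
-/

universe w

section CompactElements

/-- The compact elements of `L` are closed under finite meets. For a frame in which every element
is a join of compact ones, such as the lower sets of a preorder or the opens of a space with a basis
of compact opens, this is what it means to be a coherent frame. -/
def HasCompactFiniteInfs (L : Type*) [CompleteLattice L] : Prop :=
  IsCompactElement (⊤ : L) ∧
    ∀ a b : L, IsCompactElement a → IsCompactElement b → IsCompactElement (a ⊓ b)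

lemma HasCompactFiniteInfs.isCompactElement_iInf {L ι : Type*} [CompleteLattice L] [Finite ι]
    (h : HasCompactFiniteInfs L) {f : ι → L} (hf : ∀ i, IsCompactElement (f i)) :
    IsCompactElement (⨅ i, f i) := by
  have := Fintype.ofFinite ι
  rw [← Finset.inf_univ_eq_iInf]
  exact Finset.inf_induction h.1 (fun a ha b hb => h.2 a b ha hb) fun i _ => hf i

lemma isCompactElement_orderIso {L M : Type*} [PartialOrder L] [PartialOrder M] (e : L ≃o M)
    {a : L} (ha : IsCompactElement a) : IsCompactElement (e a) := by
  intro s u hne hdir hu hau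
  obtain ⟨_, ⟨m, hm, rfl⟩, ham⟩ := ha (e.symm '' s) (e.symm u) (hne.image _)
    (hdir.mono_comp fun _ _ h => e.symm.monotone h) (e.symm.isLUB_image'.2 hu)
    (e.le_symm_apply.2 hau)
  exact ⟨m, hm, e.le_symm_apply.1 ham⟩

lemma isCompactElement_orderIso_iff {L M : Type*} [PartialOrder L] [PartialOrder M] (e : L ≃o M)
    {a : L} : IsCompactElement (e a) ↔ IsCompactElement a :=
  ⟨fun h => by simpa using isCompactElement_orderIso e.symm h, isCompactElement_orderIso e⟩

lemma HasCompactFiniteInfs.congr {L M : Type*} [CompleteLattice L] [CompleteLattice M]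
    (e : L ≃o M) : HasCompactFiniteInfs L ↔ HasCompactFiniteInfs M := by
  simp only [HasCompactFiniteInfs, e.symm.surjective.forall, ← map_inf,
    isCompactElement_orderIso_iff, ← isCompactElement_orderIso_iff e (a := ⊤), map_top]

end CompactElements

section LowerSets

variable {P : Type u} [Preorder P]

lemma isCompactElement_lowerSet_Iic (p : P) : IsCompactElement (LowerSet.Iic p) := by
  rw [CompleteLattice.isCompactElement_iff_le_of_directed_sSup_le]
  intro s _ _ hp
  simpa only [LowerSet.Iic_le, LowerSet.mem_sSup_iff] using hp

lemma isCompactElement_lowerSet_iff_exists_finset {S : LowerSet P} :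
    IsCompactElement S ↔ ∃ s : Finset P, S = s.sup LowerSet.Iic := by
  refine ⟨fun hS => ?_, ?_⟩
  · classical
    obtain ⟨s, hs⟩ := CompleteLattice.IsCompactElement.exists_finset_of_le_iSup _ hS
      (fun p : S => LowerSet.Iic p.1) fun p hp => LowerSet.mem_iSup_iff.2 ⟨⟨p, hp⟩, le_rfl⟩
    refine ⟨s.image Subtype.val, le_antisymm ?_ (Finset.sup_le fun p hp => ?_)⟩
    · rwa [Finset.sup_image, Finset.sup_eq_iSup]
    · obtain ⟨p, -, rfl⟩ := Finset.mem_image.1 hp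
      exact LowerSet.Iic_le.2 p.2
  · rintro ⟨s, rfl⟩
    exact CompleteLattice.isCompactElement_finsetSup s fun p _ => isCompactElement_lowerSet_Iic p

lemma mem_finset_sup_Iic {s : Finset P} {p : P} : p ∈ s.sup LowerSet.Iic ↔ ∃ q ∈ s, p ≤ q := by
  simp [Finset.sup_eq_iSup]

lemma isCompactElement_lowerSet_iff_hasFiniteCofinalList {S : LowerSet P} :
    IsCompactElement S ↔ HasFiniteCofinalList ↥(S : Set P) := by
  rw [isCompactElement_lowerSet_iff_exists_finset]
  constructor
  · rintro ⟨s, rfl⟩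
    refine ⟨s.attach.toList.map fun q : {q // q ∈ s} =>
      ⟨q, mem_finset_sup_Iic.2 ⟨q, q.2, le_rfl⟩⟩, ?_⟩
    rintro ⟨p, hp⟩
    obtain ⟨q, hq, hpq⟩ := mem_finset_sup_Iic.1 hp
    exact ⟨_, List.mem_map_of_mem (Finset.mem_toList.2 (Finset.mem_attach s ⟨q, hq⟩)), hpq⟩
  · classical
    rintro ⟨l, hl⟩
    refine ⟨(l.map Subtype.val).toFinset, le_antisymm (fun p hp => ?_)
      (Finset.sup_le fun p hp => ?_)⟩
    · obtain ⟨q, hq, hpq⟩ := hl ⟨p, hp⟩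
      exact mem_finset_sup_Iic.2 ⟨q, List.mem_toFinset.2 (List.mem_map_of_mem hq), hpq⟩
    · obtain ⟨q, -, rfl⟩ := List.mem_map.1 (List.mem_toFinset.1 hp)
      exact LowerSet.Iic_le.2 q.2

lemma HasFiniteCofinalList.congr {Q R : Type u} [Preorder Q] [Preorder R] (e : Q ≃o R) :
    HasFiniteCofinalList Q ↔ HasFiniteCofinalList R := by
  suffices h : ∀ {Q R : Type u} [Preorder Q] [Preorder R], Q ≃o R →
      HasFiniteCofinalList Q → HasFiniteCofinalList R from ⟨h e, h e.symm⟩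
  rintro Q R _ _ e ⟨l, hl⟩
  refine ⟨l.map e, e.surjective.forall.2 fun p => ?_⟩
  obtain ⟨t, ht, hpt⟩ := hl p
  exact ⟨e t, List.mem_map_of_mem ht, e.monotone hpt⟩

lemma hasCompactFiniteInfs_lowerSet_iff :
    HasCompactFiniteInfs (LowerSet P) ↔ IsCompactElement (⊤ : LowerSet P) ∧
      ∀ p q : P, IsCompactElement (LowerSet.Iic p ⊓ LowerSet.Iic q) := by
  refine and_congr_right fun _ => ⟨fun h p q => h _ _ (isCompactElement_lowerSet_Iic p)
    (isCompactElement_lowerSet_Iic q), fun h S T hS hT => ?_⟩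
  obtain ⟨s, rfl⟩ := isCompactElement_lowerSet_iff_exists_finset.1 hS
  obtain ⟨t, rfl⟩ := isCompactElement_lowerSet_iff_exists_finset.1 hT
  rw [Finset.sup_inf_sup]
  exact CompleteLattice.isCompactElement_finsetSup _ fun pq _ => h pq.1 pq.2

theorem hasCompactFiniteInfs_lowerSet_iff_hasFiniteCofinalList :
    HasCompactFiniteInfs (LowerSet P) ↔ HasFiniteCofinalList P ∧
      ∀ p q : P, HasFiniteCofinalList ↥(Set.Iic p ∩ Set.Iic q) := by
  simp only [hasCompactFiniteInfs_lowerSet_iff, isCompactElement_lowerSet_iff_hasFiniteCofinalList]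
  exact and_congr_left' (HasFiniteCofinalList.congr OrderIso.Set.univ)

end LowerSets

section Spectral

open TopologicalSpace

theorem spectralSpace_iff_hasCompactFiniteInfs_opens {X : Type*} [TopologicalSpace X] [T0Space X]
    [QuasiSober X] [PrespectralSpace X] :
    SpectralSpace X ↔ HasCompactFiniteInfs (Opens X) := by
  simp only [HasCompactFiniteInfs, Opens.isCompactElement_iff, Opens.coe_top, Opens.coe_inf]
  constructor
  · intro _
    exact ⟨isCompact_univ, fun U V hU hV => hU.inter_of_isOpen hV U.isOpen V.isOpen⟩
  · rintro ⟨htop, hinf⟩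
    have : CompactSpace X := ⟨htop⟩
    have : QuasiSeparatedSpace X :=
      ⟨fun U V hU hUc hV hVc => hinf ⟨U, hU⟩ ⟨V, hV⟩ hUc hVc⟩
    exact {}

end Spectral


/-- The space `FilterDcpo P` of filters with the Scott topology, over an arbitrary preorder. -/
abbrev FilterSpace (P : Type u) [Preorder P] : Type u :=
  Topology.WithScott (Order.PFilter P)

namespace FilterSpace

open Topology TopologicalSpace Order

variable {P : Type u} [Preorder P]

/-- The principal filter of `p`. -/
def point (p : P) : FilterSpace P :=
  WithScott.toScott (PFilter.principal p)

lemma isPFilter_iUnion {d : Set (FilterSpace P)} (hne : d.Nonempty)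
    (hd : ∀ p q, (∃ F ∈ d, p ∈ WithScott.ofScott F) → (∃ F ∈ d, q ∈ WithScott.ofScott F) →
      ∃ F ∈ d, p ∈ WithScott.ofScott F ∧ q ∈ WithScott.ofScott F) :
    IsPFilter {p : P | ∃ F ∈ d, p ∈ WithScott.ofScott F} := by
  refine IsPFilter.of_def ?_ (fun p hp q hq => ?_) ?_
  · obtain ⟨F, hF⟩ := hne
    obtain ⟨p, hp⟩ := (WithScott.ofScott F).nonempty
    exact ⟨p, F, hF, hp⟩
  · obtain ⟨F, hF, hpF, hqF⟩ := hd p q hp hq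
    obtain ⟨r, hr, hrp, hrq⟩ := (WithScott.ofScott F).directed p hpF q hqF
    exact ⟨r, ⟨F, hF, hr⟩, hrp, hrq⟩
  · rintro p q hpq ⟨F, hF, hp⟩
    exact ⟨F, hF, PFilter.mem_of_le hpq hp⟩

lemma isPFilter_iUnion_of_directedOn {d : Set (FilterSpace P)} (hne : d.Nonempty)
    (hd : DirectedOn (· ≤ ·) d) : IsPFilter {p : P | ∃ F ∈ d, p ∈ WithScott.ofScott F} :=
  isPFilter_iUnion hne fun _ _ ⟨F, hF, hp⟩ ⟨G, hG, hq⟩ =>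
    let ⟨H, hH, hFH, hGH⟩ := hd F hF G hG
    ⟨H, hH, hFH hp, hGH hq⟩

/-- The open set of filters containing `p`; these form a basis of compact opens. -/
def basicOpen (p : P) : Opens (FilterSpace P) where
  carrier := {F | p ∈ WithScott.ofScott F}
  is_open' := by
    rw [IsScott.isOpen_iff_isUpperSet_and_dirSupInaccOn (D := Set.univ)]
    refine ⟨fun F G hFG hF => hFG hF, fun d _ hne hd F hF hp => ?_⟩
    have hle : F ≤ WithScott.toScott (isPFilter_iUnion_of_directedOn hne hd).toPFilter :=
      hF.2 fun G hG q hq => ⟨G, hG, hq⟩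
    exact hle hp

lemma mem_basicOpen {p : P} {F : FilterSpace P} : F ∈ basicOpen p ↔ p ∈ WithScott.ofScott F :=
  Iff.rfl

lemma point_mem_basicOpen {p q : P} : point p ∈ basicOpen q ↔ p ≤ q :=
  PFilter.mem_principal

lemma point_le_iff {p : P} {F : FilterSpace P} : point p ≤ F ↔ F ∈ basicOpen p :=
  PFilter.principal_le_iff

lemma basicOpen_le_iff {p : P} {U : Opens (FilterSpace P)} : basicOpen p ≤ U ↔ point p ∈ U :=
  ⟨fun h => h (point_mem_basicOpen.2 le_rfl), fun hp _ hF =>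
    IsScott.isUpperSet_of_isOpen (D := Set.univ) U.isOpen (point_le_iff.2 hF) hp⟩

lemma basicOpen_le_basicOpen {p q : P} : basicOpen p ≤ basicOpen q ↔ p ≤ q :=
  basicOpen_le_iff.trans point_mem_basicOpen

lemma directedOn_point_image (F : FilterSpace P) :
    DirectedOn (· ≤ ·) (point '' {p | F ∈ basicOpen p}) := by
  rintro _ ⟨p, hp, rfl⟩ _ ⟨q, hq, rfl⟩
  obtain ⟨r, hr, hrp, hrq⟩ := (WithScott.ofScott F).directed p hp q hq
  exact ⟨_, ⟨r, hr, rfl⟩, point_le_iff.2 (point_mem_basicOpen.2 hrp),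
    point_le_iff.2 (point_mem_basicOpen.2 hrq)⟩

lemma isLUB_point_image (F : FilterSpace P) : IsLUB (point '' {p | F ∈ basicOpen p}) F := by
  refine ⟨?_, fun G hG p hp => ?_⟩
  · rintro _ ⟨p, hp, rfl⟩
    exact point_le_iff.2 hp
  · exact mem_basicOpen.1 (point_le_iff.1 (hG ⟨p, hp, rfl⟩))

lemma exists_mem_basicOpen_point_mem {U : Opens (FilterSpace P)} {F : FilterSpace P}
    (hF : F ∈ U) : ∃ p, F ∈ basicOpen p ∧ point p ∈ U := by
  have hU := ((IsScott.isOpen_iff_isUpperSet_and_dirSupInaccOn (D := Set.univ)).1 U.isOpen).2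
  obtain ⟨_, ⟨p, hp, rfl⟩, hpU⟩ := hU (Set.mem_univ _) ((WithScott.ofScott F).nonempty.image point)
    (directedOn_point_image F) (isLUB_point_image F) hF
  exact ⟨p, hp, hpU⟩

lemma isBasis_range_basicOpen :
    Opens.IsBasis (Set.range (basicOpen : P → Opens (FilterSpace P))) := by
  refine Opens.isBasis_iff_nbhd.2 fun {U F} hF => ?_
  obtain ⟨p, hFp, hp⟩ := exists_mem_basicOpen_point_mem hF
  exact ⟨_, ⟨p, rfl⟩, hFp, basicOpen_le_iff.2 hp⟩

lemma isCompact_basicOpen (p : P) : IsCompact (basicOpen p : Set (FilterSpace P)) := by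
  refine isCompact_of_finite_subcover fun U hU hc => ?_
  obtain ⟨i, hi⟩ := Set.mem_iUnion.1 (hc (point_mem_basicOpen.2 le_rfl))
  exact ⟨{i}, by simpa using SetLike.coe_subset_coe.2 (basicOpen_le_iff (U := ⟨U i, hU i⟩).2 hi)⟩

instance : PrespectralSpace (FilterSpace P) :=
  .of_isTopologicalBasis isBasis_range_basicOpen (by
    rintro _ ⟨_, ⟨p, rfl⟩, rfl⟩
    exact isCompact_basicOpen p)

instance : T0Space (FilterSpace P) :=
  ⟨fun _ _ h => SetLike.ext (A := PFilter P) fun p => h.mem_open_iff (basicOpen p).isOpen⟩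

lemma isPFilter_iUnion_of_isIrreducible {Z : Set (FilterSpace P)} (hZ : IsIrreducible Z) :
    IsPFilter {p : P | ∃ F ∈ Z, p ∈ WithScott.ofScott F} :=
  isPFilter_iUnion hZ.nonempty fun p q hp hq =>
    hZ.isPreirreducible _ _ (basicOpen p).isOpen (basicOpen q).isOpen hp hq

instance : QuasiSober (FilterSpace P) where
  sober {Z} hZ hZc := by
    refine ⟨WithScott.toScott (isPFilter_iUnion_of_isIrreducible hZ).toPFilter, Set.Subset.antisymm
      (closure_minimal (Set.singleton_subset_iff.2 ?_) hZc) fun G hG => ?_⟩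
    · by_contra hn
      obtain ⟨p, hp, hpZ⟩ :=
        exists_mem_basicOpen_point_mem (U := ⟨Zᶜ, hZc.isOpen_compl⟩) hn
      obtain ⟨G, hG, hGp⟩ := hp
      exact basicOpen_le_iff.2 hpZ hGp hG
    · rw [IsTopologicalBasis.mem_closure_iff isBasis_range_basicOpen]
      rintro _ ⟨_, ⟨p, rfl⟩, rfl⟩ hGp
      exact ⟨_, (⟨G, hG, hGp⟩ : ∃ G ∈ Z, p ∈ WithScott.ofScott G), rfl⟩

/-- Since the `basicOpen p` are join-prime and form a basis, an open set is the same thing as a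
lower set of indices. -/
def opensEquivLowerSet : Opens (FilterSpace P) ≃o LowerSet P where
  toFun U := ⟨{p | point p ∈ U}, fun _ _ hqp hp =>
    basicOpen_le_iff.1 ((basicOpen_le_basicOpen.2 hqp).trans (basicOpen_le_iff.2 hp))⟩
  invFun S := ⨆ p : S, basicOpen p.1
  left_inv U := by
    ext F
    simp only [SetLike.mem_coe, Opens.mem_iSup]
    constructor
    · rintro ⟨⟨p, hp⟩, hF⟩
      exact basicOpen_le_iff.2 hp hF
    · intro hF
      obtain ⟨p, hFp, hp⟩ := exists_mem_basicOpen_point_mem hF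
      exact ⟨⟨p, hp⟩, hFp⟩
  right_inv S := by
    ext p
    simp only [SetLike.mem_coe, LowerSet.mem_mk, Set.mem_ofPred_eq, Opens.mem_iSup,
      point_mem_basicOpen]
    exact ⟨fun ⟨q, hpq⟩ => S.lower hpq q.2, fun hp => ⟨⟨p, hp⟩, le_rfl⟩⟩
  map_rel_iff' {U V} := by
    refine ⟨fun h F hF => ?_, fun h p hp => h hp⟩
    obtain ⟨p, hFp, hp⟩ := exists_mem_basicOpen_point_mem hF
    exact basicOpen_le_iff.2 (h hp) hFp

theorem spectralSpace_iff_hasCompactFiniteInfs_lowerSet :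
    SpectralSpace (FilterSpace P) ↔ HasCompactFiniteInfs (LowerSet P) :=
  spectralSpace_iff_hasCompactFiniteInfs_opens.trans (HasCompactFiniteInfs.congr opensEquivLowerSet)

/-- `basicOpen` as a functor, which exhibits `P` as a dense subsite of the opens. -/
def basicOpenFunctor (P : Type u) [Preorder P] : P ⥤ Opens (TopCat.of (FilterSpace P)) :=
  Monotone.functor (f := basicOpen) fun _ _ => basicOpen_le_basicOpen.2

instance : (basicOpenFunctor P).Full where
  map_surjective f := ⟨homOfLE (basicOpen_le_basicOpen.1 (leOfHom f)), Subsingleton.elim _ _⟩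

instance : (basicOpenFunctor P).Faithful where
  map_injective _ := Subsingleton.elim _ _

instance : (basicOpenFunctor P).IsDenseSubsite (⊥ : GrothendieckTopology P)
    (Opens.grothendieckTopology (TopCat.of (FilterSpace P))) where
  isCoverDense' := (TopCat.Opens.coverDense_iff_isBasis _).2 isBasis_range_basicOpen
  functorPushforward_mem_iff {p S} := by
    rw [GrothendieckTopology.bot_covering]
    constructor
    · intro h
      obtain ⟨U, f, ⟨q, g, k, hg, -⟩, hU⟩ := h (point p) (point_mem_basicOpen.2 le_rfl)
      have hpq : p ≤ q := point_mem_basicOpen.1 (leOfHom k hU)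
      rw [← Sieve.id_mem_iff_eq_top]
      exact (Subsingleton.elim (homOfLE hpq ≫ g) (𝟙 p)) ▸ S.downward_closed hg (homOfLE hpq)
    · rintro rfl
      rw [Sieve.functorPushforward_top]
      exact GrothendieckTopology.top_mem _ _

/-- Presheaves on `P` are the sheaves on `FilterSpace P`, by the comparison lemma. -/
noncomputable def presheafEquivalence (P : Type u) [Preorder P] :
    (Pᵒᵖ ⥤ Type u) ≌ TopCat.Sheaf (Type u) (TopCat.of (FilterSpace P)) :=
  (sheafBotEquivalence (Type u)).symm.trans
    (Functor.IsDenseSubsite.sheafEquiv (⊥ : GrothendieckTopology P)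
      (Opens.grothendieckTopology (TopCat.of (FilterSpace P))) (basicOpenFunctor P) (Type u))

end FilterSpace

section Equivalences

variable {C : Type*} [Category.{v} C] {D : Type*} [Category.{v} D]

lemma IsEpimorphicFamily.map_of_adjunction {L : C ⥤ D} {R : D ⥤ C} (adj : L ⊣ R) {ι : Type v}
    {E : C} {F : ι → C} {f : ∀ i, F i ⟶ E} (hf : IsEpimorphicFamily f) :
    IsEpimorphicFamily fun i => L.map (f i) := by
  intro Z g h hgh
  apply (adj.homEquiv _ _).injective
  refine hf _ _ fun i => ?_
  rw [← adj.homEquiv_naturality_left, ← adj.homEquiv_naturality_left, hgh i]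

lemma IsEpimorphicFamily.of_map {L : C ⥤ D} [L.Faithful] {ι : Type v} {E : C} {F : ι → C}
    {f : ∀ i, F i ⟶ E} (hf : IsEpimorphicFamily fun i => L.map (f i)) : IsEpimorphicFamily f :=
  fun Z g h hgh => L.map_injective (hf _ _ fun i => by simp only [← L.map_comp, hgh i])

lemma IsCompactObject.of_equivalence (e : C ≌ D) {E : D}
    (hE : IsCompactObject (e.inverse.obj E)) : IsCompactObject E := by
  intro ι F f hf
  obtain ⟨s, hs⟩ := hE _ _ (hf.map_of_adjunction e.symm.toAdjunction)
  exact ⟨s, IsEpimorphicFamily.of_map (L := e.inverse) hs⟩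

lemma IsGrothendieckTopos.of_equivalence (e : C ≌ D) (h : IsGrothendieckTopos C) :
    IsGrothendieckTopos D := by
  obtain ⟨S, _, J, ⟨e'⟩⟩ := h
  exact ⟨S, _, J, ⟨e.symm.trans e'⟩⟩

lemma isClosedUnderIsomorphisms_of_isClosedUnderLimitsOfShape (K : ObjectProperty C) (J : Type*)
    [Category* J] [IsConnected J] [K.IsClosedUnderLimitsOfShape J] :
    K.IsClosedUnderIsomorphisms where
  of_iso {X _} i hX := K.limitsOfShape_le J _ ((K.limitsOfShape J).prop_of_iso i
    ⟨{ diag := _, π := _, isLimit := isLimitConstCone J X, prop_diag_obj := fun _ => hX }⟩)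

theorem IsCoherentTopos.of_equivalence (e : C ≌ D) (h : IsCoherentTopos C) :
    IsCoherentTopos D := by
  obtain ⟨hC, K, hc, hs, hl⟩ := h
  have := hl (Discrete PUnit)
  have := isClosedUnderIsomorphisms_of_isClosedUnderLimitsOfShape K (Discrete PUnit)
  refine ⟨hC.of_equivalence e, K.inverseImage e.inverse,
    fun E hE => (hc _ hE).of_equivalence e, ?_, fun J _ _ => ?_⟩
  · refine (hs.of_equivalence e).of_le ?_
    rintro _ ⟨X, hX⟩
    exact K.prop_of_iso (e.unitIso.app X) hX
  · have := hl J
    infer_instance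

end Equivalences

section Presheaves

open Opposite

lemma iSup_range_eq_top_of_jointly_epi {C : Type*} [Category* C] {ι : Type*} {E : C ⥤ Type w}
    {F : ι → C ⥤ Type w} (f : ∀ i, F i ⟶ E)
    (hf : ∀ ⦃Z : C ⥤ Type w⦄ (g h : E ⟶ Z), (∀ i, f i ≫ g = f i ≫ h) → g = h) :
    ⨆ i, Subfunctor.range (f i) = ⊤ := by
  set S := ⨆ i, Subfunctor.range (f i)
  have hfS (i) : Subfunctor.range (f i) ≤ S := le_iSup (fun i => Subfunctor.range (f i)) i
  have : Epi S.ι := ⟨fun g h hgh => hf g h fun i => by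
    rw [← Subfunctor.lift_ι (f i) (hfS i), Category.assoc, Category.assoc, hgh]⟩
  rw [← Subfunctor.range_ι S, Subfunctor.range_eq_top]

theorem isEpimorphicFamily_iff_iSup_range_eq_top {C : Type u} [Category.{v} C]
    {ι : Type max u w} {E : C ⥤ Type w} {F : ι → C ⥤ Type w} {f : ∀ i, F i ⟶ E} :
    IsEpimorphicFamily f ↔ ⨆ i, Subfunctor.range (f i) = ⊤ := by
  refine ⟨iSup_range_eq_top_of_jointly_epi f, fun hf Z g h hgh => ?_⟩
  ext X x
  have hx : x ∈ (⨆ i, Subfunctor.range (f i)).obj X := hf ▸ trivial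
  obtain ⟨i, y, rfl⟩ := by simpa only [Subfunctor.iSup_obj, Set.mem_iUnion] using hx
  exact ConcreteCategory.congr_hom (NatTrans.congr_app (hgh i) X) y

theorem isCompactObject_iff_presheafIsFinite {C : Type u} [Category.{v} C]
    {E : Cᵒᵖ ⥤ Type w} : IsCompactObject E ↔ PresheafIsFinite E := by
  classical
  simp only [IsCompactObject, isEpimorphicFamily_iff_iSup_range_eq_top]
  constructor
  · intro h
    have hcover : ⨆ x : Σ X, E.obj X, Subfunctor.range (Subfunctor.ofSection x.2).ι = ⊤ := by
      simp only [Subfunctor.range_ι, eq_top_iff]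
      intro X x _
      exact le_iSup (fun x : Σ X, E.obj X => Subfunctor.ofSection x.2) ⟨X, x⟩ X
        (Subfunctor.mem_ofSection_obj x)
    obtain ⟨s, hs⟩ := h _ _ hcover
    simp only [Subfunctor.range_ι] at hs
    exact Subfunctor.IsGeneratedBy.isFinite (G := ⊤) (x := fun i : {i // i ∈ s} => i.1.2) hs
  · intro _ ι F f hf
    have hgen := presheafIsGeneratedBy_of_isFinite E
    have hlift (k) : ∃ i, Subfunctor.IsFinite.x (G := (⊤ : Subfunctor E)) k ∈
        (Subfunctor.range (f i)).obj _ := by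
      rw [← Set.mem_iUnion, ← Subfunctor.iSup_obj, hf]
      trivial
    choose i hi using hlift
    have := Fintype.ofFinite (Subfunctor.IsFinite.Index (⊤ : Subfunctor E))
    refine ⟨Finset.univ.image i, eq_top_iff.2 (hgen.iSup_eq.ge.trans (iSup_le fun k => ?_))⟩
    rw [Subfunctor.ofSection_le_iff]
    exact le_iSup (fun j : {j // j ∈ Finset.univ.image i} => Subfunctor.range (f j.1))
      ⟨i k, Finset.mem_image_of_mem i (Finset.mem_univ k)⟩ _ (hi k)

end Presheaves

section Support

open Opposite

variable {P : Type u} [Preorder P]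

/-- The elements of `P` over which a presheaf has a section. On subterminal presheaves this is
the isomorphism of frames between subterminal presheaves and lower sets. -/
def support (E : Pᵒᵖ ⥤ Type w) : LowerSet P where
  carrier := {p | Nonempty (E.obj (op p))}
  lower' _ _ hqp := Nonempty.map (E.map (homOfLE hqp).op)

lemma mem_support {E : Pᵒᵖ ⥤ Type w} {p : P} : p ∈ support E ↔ Nonempty (E.obj (op p)) :=
  Iff.rfl

lemma support_mono {E E' : Pᵒᵖ ⥤ Type w} (f : E ⟶ E') : support E ≤ support E' :=
  fun p => Nonempty.map (f.app (op p))

lemma support_eq_iSup_Iic {E : Pᵒᵖ ⥤ Type w} {ι : Type*} {X : ι → Pᵒᵖ} {x : ∀ i, E.obj (X i)}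
    (h : PresheafIsGeneratedBy E x) : support E = ⨆ i, LowerSet.Iic (X i).unop := by
  refine le_antisymm (fun p ⟨y⟩ => ?_) (iSup_le fun i => LowerSet.Iic_le.2 ⟨x i⟩)
  have hy : y ∈ (⨆ i, Subfunctor.ofSection (x i)).obj (op p) := h.iSup_eq ▸ trivial
  obtain ⟨i, f, -⟩ := by simpa only [Subfunctor.iSup_obj, Set.mem_iUnion] using hy
  exact LowerSet.mem_iSup_iff.2 ⟨i, leOfHom f.unop⟩

lemma isCompactElement_support (E : Pᵒᵖ ⥤ Type w) [PresheafIsFinite E] :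
    IsCompactElement (support E) := by
  have := Fintype.ofFinite (Subfunctor.IsFinite.Index (⊤ : Subfunctor E))
  rw [support_eq_iSup_Iic (presheafIsGeneratedBy_of_isFinite E), ← Finset.sup_univ_eq_iSup]
  exact CompleteLattice.isCompactElement_finsetSup _ fun _ _ => isCompactElement_lowerSet_Iic _

lemma mem_support_iff_nonempty_hom {E : Pᵒᵖ ⥤ Type u} {p : P} :
    p ∈ support E ↔ Nonempty (yoneda.obj p ⟶ E) :=
  yonedaEquiv.nonempty_congr.symm

lemma support_yoneda (p : P) : support (yoneda.obj p) = LowerSet.Iic p := by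
  ext q
  exact ⟨fun ⟨f⟩ => leOfHom f, fun h => ⟨homOfLE h⟩⟩

lemma support_terminal : support (⊤_ (Pᵒᵖ ⥤ Type u)) = ⊤ :=
  eq_top_iff.2 fun _ _ => mem_support_iff_nonempty_hom.2 ⟨terminal.from _⟩

lemma support_prod (E E' : Pᵒᵖ ⥤ Type u) : support (E ⨯ E') = support E ⊓ support E' := by
  refine le_antisymm (le_inf (support_mono prod.fst) (support_mono prod.snd)) fun p hp => ?_
  obtain ⟨⟨f⟩, ⟨g⟩⟩ := hp.imp mem_support_iff_nonempty_hom.1 mem_support_iff_nonempty_hom.1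
  exact mem_support_iff_nonempty_hom.2 ⟨prod.lift f g⟩

lemma isSubterminal_yoneda (p : P) : IsSubterminal (yoneda.obj p) := fun _ f g => by
  ext
  exact Subsingleton.elim (α := (_ : P) ⟶ _) _ _

lemma isSubterminal_of_isLimit {C J : Type*} [Category* C] [Category* J] {F : J ⥤ C} {c : Cone F}
    (hc : IsLimit c) (hF : ∀ j, IsSubterminal (F.obj j)) : IsSubterminal c.pt :=
  fun _ _ _ => hc.hom_ext fun j => hF j _ _

lemma support_of_isLimit {J : Type*} [Category* J] {F : J ⥤ Pᵒᵖ ⥤ Type u} {c : Cone F}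
    (hc : IsLimit c) (hF : ∀ j, IsSubterminal (F.obj j)) :
    support c.pt = ⨅ j, support (F.obj j) := by
  refine le_antisymm (le_iInf fun j => support_mono (c.π.app j)) fun p hp => ?_
  have f j := (mem_support_iff_nonempty_hom.1 (LowerSet.mem_iInf_iff.1 hp j)).some
  exact mem_support_iff_nonempty_hom.2
    ⟨hc.lift ⟨_, { app := f, naturality := fun _ j _ => hF j _ _ }⟩⟩

lemma presheafIsFinite_of_isSubterminal {E : Pᵒᵖ ⥤ Type u} (hE : IsSubterminal E)
    (hsupp : IsCompactElement (support E)) : PresheafIsFinite E := by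
  obtain ⟨s, hs⟩ := isCompactElement_lowerSet_iff_exists_finset.1 hsupp
  have hsec (p : {p // p ∈ s}) : p.1 ∈ support E := hs ▸ mem_finset_sup_Iic.2 ⟨p, p.2, le_rfl⟩
  have x p := (mem_support.1 (hsec p)).some
  refine Subfunctor.IsGeneratedBy.isFinite (G := ⊤) (x := x) (eq_top_iff.2 fun q y _ => ?_)
  have hq : q.unop ∈ s.sup LowerSet.Iic := hs ▸ mem_support.2 ⟨y⟩
  obtain ⟨p, hp, hqp⟩ := mem_finset_sup_Iic.1 hq
  rw [Subfunctor.iSup_obj, Set.mem_iUnion]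
  exact ⟨⟨p, hp⟩, (homOfLE hqp).op, yonedaEquiv.symm.injective (hE _ _)⟩

/-- The finitely generated subterminal presheaves. They generate the topos, and they are closed
under finite limits as soon as the compact lower sets are closed under finite meets. -/
def compactSubterminals (P : Type u) [Preorder P] : ObjectProperty (Pᵒᵖ ⥤ Type u) :=
  fun E => IsSubterminal E ∧ IsCompactElement (support E)

lemma isSeparating_compactSubterminals : (compactSubterminals P).IsSeparating :=
  fun _ _ _ _ h => hom_ext_yoneda fun p k => h _
    ⟨isSubterminal_yoneda p, support_yoneda p ▸ isCompactElement_lowerSet_Iic p⟩ k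

lemma isClosedUnderLimitsOfShape_compactSubterminals (h : HasCompactFiniteInfs (LowerSet P))
    (J : Type*) [Category* J] [Finite J] :
    (compactSubterminals P).IsClosedUnderLimitsOfShape J where
  limitsOfShape_le := by
    rintro E ⟨l⟩
    have hsub j := (l.prop_diag_obj j).1
    refine ⟨isSubterminal_of_isLimit l.isLimit hsub, ?_⟩
    rw [show support E = _ from support_of_isLimit l.isLimit hsub]
    exact h.isCompactElement_iInf fun j => (l.prop_diag_obj j).2

lemma exists_support_eq_Iic_of_isSeparating {K : ObjectProperty (Pᵒᵖ ⥤ Type u)}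
    (hK : K.IsSeparating) (p : P) : ∃ E, K E ∧ support E = LowerSet.Iic p := by
  have hcover := iSup_range_eq_top_of_jointly_epi
    (fun i : Σ E : {E // K E}, E.1 ⟶ yoneda.obj p => i.2)
    fun _ g h hgh => hK g h fun E hE f => hgh ⟨⟨E, hE⟩, f⟩
  -- A section of `E` over `p` that lifts `𝟙 p` puts `p` into the support of `E`.
  have hid : 𝟙 p ∈ (⊤ : Subfunctor (yoneda.obj p)).obj (op p) := trivial
  rw [← hcover, Subfunctor.iSup_obj, Set.mem_iUnion] at hid
  obtain ⟨⟨⟨E, hE⟩, f⟩, x, -⟩ := hid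
  exact ⟨E, hE, le_antisymm (support_yoneda p ▸ support_mono f) (LowerSet.Iic_le.2 ⟨x⟩)⟩

lemma isGrothendieckTopos_presheaf (C : Type u) [SmallCategory C] :
    IsGrothendieckTopos (Cᵒᵖ ⥤ Type u) :=
  ⟨C, inferInstance, ⊥, ⟨(sheafBotEquivalence (Type u)).symm⟩⟩

theorem isCoherentTopos_presheaf_iff :
    IsCoherentTopos (Pᵒᵖ ⥤ Type u) ↔ HasCompactFiniteInfs (LowerSet P) := by
  constructor
  · rintro ⟨-, K, hcompact, hsep, hlim⟩
    have hsupp {E} (hE : K E) : IsCompactElement (support E) :=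
      have := isCompactObject_iff_presheafIsFinite.1 (hcompact E hE)
      isCompactElement_support E
    have := hlim (Discrete PEmpty)
    have := hlim (Discrete WalkingPair)
    refine hasCompactFiniteInfs_lowerSet_iff.2 ⟨?_, fun p q => ?_⟩
    · rw [← support_terminal]
      exact hsupp (K.prop_limit _ nofun)
    · obtain ⟨E, hE, hEp⟩ := exists_support_eq_Iic_of_isSeparating hsep p
      obtain ⟨E', hE', hEq⟩ := exists_support_eq_Iic_of_isSeparating hsep q
      rw [← hEp, ← hEq, ← support_prod]
      exact hsupp (K.prop_limit _ (by rintro ⟨_ | _⟩ <;> assumption))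
  · intro h
    exact ⟨isGrothendieckTopos_presheaf P, compactSubterminals P,
      fun E hE => isCompactObject_iff_presheafIsFinite.2
        (presheafIsFinite_of_isSubterminal hE.1 hE.2),
      isSeparating_compactSubterminals,
      fun J _ _ => isClosedUnderLimitsOfShape_compactSubterminals h J⟩

end Support

theorem mainTheorem3_general (P : Type u) [Preorder P] :
    Nonempty ((Pᵒᵖ ⥤ Type u) ≌ TopCat.Sheaf (Type u) (TopCat.of (FilterSpace P))) ∧
    List.TFAE [
      IsCoherentTopos (Pᵒᵖ ⥤ Type u),
      IsCoherentTopos (TopCat.Sheaf (Type u) (TopCat.of (FilterSpace P))),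
      SpectralSpace (FilterSpace P),
      HasFiniteCofinalList P ∧
        ∀ p q : P, HasFiniteCofinalList ↥(Set.Iic p ∩ Set.Iic q)] := by
  refine ⟨⟨FilterSpace.presheafEquivalence P⟩, ?_⟩
  tfae_have 1 → 2 := .of_equivalence (FilterSpace.presheafEquivalence P)
  tfae_have 2 → 1 := .of_equivalence (FilterSpace.presheafEquivalence P).symm
  tfae_have 1 ↔ 4 :=
    isCoherentTopos_presheaf_iff.trans hasCompactFiniteInfs_lowerSet_iff_hasFiniteCofinalList
  tfae_have 3 ↔ 4 := FilterSpace.spectralSpace_iff_hasCompactFiniteInfs_lowerSet.trans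
    hasCompactFiniteInfs_lowerSet_iff_hasFiniteCofinalList
  tfae_finish

theorem mainTheorem3 (P : Type u) [PartialOrder P] :
    Nonempty ((Pᵒᵖ ⥤ Type u) ≌ TopCat.Sheaf (Type u) (TopCat.of (FilterDcpo P))) ∧
    List.TFAE [
      IsCoherentTopos (Pᵒᵖ ⥤ Type u),
      IsCoherentTopos (TopCat.Sheaf (Type u) (TopCat.of (FilterDcpo P))),
      SpectralSpace (FilterDcpo P),
      HasFiniteCofinalList P ∧
        ∀ p q : P, HasFiniteCofinalList ↥(Set.Iic p ∩ Set.Iic q)] :=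
  mainTheorem3_general P
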